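/- Let $X$ be a compact Hausdorff space (not necessarily metrizable) whose topology has a base of clopen sets, let $\mathscr{U}$ be its uniform structure, and let $f\colon X\to X$ be a homeomorphism. For $\Gamma=\{0,\pm1\}\subset\mathbb{Z}$ let $|g|$ be the length of $g\in\mathbb{Z}$ with respect to $\Gamma$ (the least number of elements of $\Gamma$ with sum $g$), and for $g\neq 0$ put $\mathcal{K}(g)=\{h+g : h \text{ is a sum of } |g|-1 \text{ elements of } \Gamma\}$. A $\Gamma$-cone is a set $C\subseteq\mathbb{Z}$ of the form $C=\limsup_i\mathcal{K}(g_i)$ for a net $(g_i)$ in $\mathbb{Z}$ with $|g_i|\nearrow\infty$ (monotonically), where $\limsup_i Y_i$ is the set of all limits of nets $y_j\in Y_{i_j}$ taken along subnets $(Y_{i_j})$ of $(Y_i)$. A point $x$ is $\Gamma$-recurrent of type I under a homeomorphism $h$ if for every $\Gamma$-cone $C$ and every neighbourhood $U$ of $x$ there is $c\in C$ with $h^cx\in U$. Then the following conditions are pairwise equivalent: 1. $(f,X)$ is pointwise product $\Gamma$-recurrent of type I, i.e. every point of $X\times X$ is $\Gamma$-recurrent of type I under $f\times f$, where $\Gamma=\{0,\pm1\}$.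 2. $(f,X)$ is weakly rigid: for every $\varepsilon\in\mathscr{U}$ and all $x_1,\dots,x_m\in X$ there is $n\in\mathbb{Z}$, $n\neq0$, with $(f^nx_i,x_i)\in\varepsilon$ for $i=1,\dots,m$. 3. $(f,X)$ is rigid: there is a net $n_k\in\mathbb{Z}$ with $n_k\nearrow+\infty$ (monotonically) such that $f^{n_k}x\to x$ for every $x\in X$. 4. $(f,X)$ is uniformly rigid: there is a net $n_k\in\mathbb{Z}$ with $n_k\nearrow+\infty$ (monotonically) such that $f^{n_k}x\to x$ uniformly in $x\in X$. 5. $(f,X)$ is equicontinuous: the family $\{f^n : n\in\mathbb{Z}\}$ is equicontinuous at every point of $X$. 6. $(f,X)$ is positively pointwise product recurrent: for every $(x_1,x_2)\in X\times X$ there is a net $n_k\to+\infty$ in $\mathbb{Z}$ with $(f^{n_k}x_1,f^{n_k}x_2)\to(x_1,x_2)$; respectively (6$'$), $(f,X)$ is negatively pointwise product recurrent: the same with $n_k\to-\infty$. Each of (6) and (6$'$) separately is equivalent to the other conditions. 7. $(f,X)$ is (uniformly) regularly almost periodic: for every $\alpha\in\mathscr{U}$ there is a syndetic normal subgroup $A$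 of $\mathbb{Z}$ such that $(x,f^ax)\in\alpha$ for all $x\in X$ and $a\in A$, where $A$ is syndetic if $\mathbb{Z}=-K+A$ for some compact (i.e. finite) $K\subseteq\mathbb{Z}$. -/

import Mathlib

open Set Filter Topology Uniformity

namespace ZeroDimFlow

/-- A space is zero-dimensional if its clopen subsets form a base of the topology. -/
def IsZeroDimensional (X : Type*) [TopologicalSpace X] : Prop :=
  TopologicalSpace.IsTopologicalBasis {s : Set X | IsClopen s}

section Cones

universe u

/-- `iterSum Γ r` is the set of all sums `γ₁ + ⋯ + γ_r` of `r` elements of `Γ`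
(the `r`-th power of `Γ`, written additively; `iterSum Γ 0 = {0}`). -/
def iterSum {G : Type u} [AddGroup G] (Γ : Set G) (r : ℕ) : Set G :=
  {g | ∃ l : List G, l.length = r ∧ (∀ γ ∈ l, γ ∈ Γ) ∧ l.sum = g}

/-- The `Γ`-length of `g`: the least `r` such that `g` is a sum of `r` elements of `Γ`. -/
noncomputable def wordLength {G : Type u} [AddGroup G] (Γ : Set G) (g : G) : ℕ :=
  sInf {r : ℕ | g ∈ iterSum Γ r}

/-- The set `𝒦(g) = Γ^(|g| - 1) · g`, written additively. -/
def coneBlock {G : Type u} [AddGroup G] (Γ : Set G) (g : G) : Set G :=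
  {k | ∃ h ∈ iterSum Γ (wordLength Γ g - 1), k = h + g}

/-- The upper limit of a net `Y : Λ → Set G` of subsets of a space `G`: all limits of nets
`y` with `y j ∈ Y (s j)`, where `Y ∘ s` is a subnet of `Y`. -/
def netLimsup {G : Type u} [TopologicalSpace G] {Λ : Type u} [Preorder Λ] (Y : Λ → Set G) :
    Set G :=
  {a | ∃ (M : Type u) (_ : Preorder M) (_ : IsDirectedOrder M) (_ : Nonempty M)
      (s : M → Λ) (y : M → G),
      Tendsto s atTop atTop ∧ (∀ j, y j ∈ Y (s j)) ∧ Tendsto y atTop (𝓝 a)}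

/-- `C` is a `Γ`-cone in `G`: there is a net `g` in `G` whose `Γ`-lengths increase to infinity
such that `C` is the upper limit of the sets `𝒦(g i)`. -/
def IsCone {G : Type u} [AddGroup G] [TopologicalSpace G] (Γ : Set G) (C : Set G) : Prop :=
  ∃ (Λ : Type u) (_ : Preorder Λ) (_ : IsDirectedOrder Λ) (_ : Nonempty Λ) (g : Λ → G),
    Monotone (fun i => wordLength Γ (g i)) ∧
    Tendsto (fun i => wordLength Γ (g i)) atTop atTop ∧
    netLimsup (fun i => coneBlock Γ (g i)) = C

end Cones

section Homeo

/-- `x` is `Γ`-recurrent of type I under the `ℤ`-flow `(n, x) ↦ fⁿ x` : for every `Γ`-cone `C`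
in `ℤ` and every neighbourhood `U` of `x`, the set `C x` meets `U`. -/
def IsRecurrentTypeI {X : Type*} [TopologicalSpace X] (Γ : Set ℤ) (f : X ≃ₜ X) (x : X) : Prop :=
  ∀ C : Set ℤ, IsCone Γ C → ∀ U ∈ 𝓝 x, ∃ c ∈ C, (f ^ c) x ∈ U

/-- Every point of `X × X` is `Γ`-recurrent of type I under `f × f`. -/
def PointwiseProductRecurrentTypeI {X : Type*} [TopologicalSpace X] (Γ : Set ℤ) (f : X ≃ₜ X) :
    Prop :=
  ∀ p : X × X, IsRecurrentTypeI Γ (f.prodCongr f) p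

/-- For every entourage `ε` and all points `x₁, …, x_m` there is `n ≠ 0` in `ℤ` with
`(fⁿ xᵢ, xᵢ) ∈ ε` for all `i`. -/
def WeaklyRigid {X : Type*} [UniformSpace X] (f : X ≃ₜ X) : Prop :=
  ∀ ε ∈ 𝓤 X, ∀ (m : ℕ) (x : Fin m → X), ∃ n : ℤ, n ≠ 0 ∧ ∀ i, ((f ^ n) (x i), x i) ∈ ε

/-- There is a net of integers increasing to `+∞` along which `fⁿ x → x` for every `x`. -/
def Rigid {X : Type*} [TopologicalSpace X] (f : X ≃ₜ X) : Prop :=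
  ∃ (Λ : Type) (_ : Preorder Λ) (_ : IsDirectedOrder Λ) (_ : Nonempty Λ) (n : Λ → ℤ),
    Monotone n ∧ Tendsto n atTop atTop ∧
    ∀ x : X, Tendsto (fun k => (f ^ n k) x) atTop (𝓝 x)

/-- There is a net of integers increasing to `+∞` along which `fⁿ x → x` uniformly in `x`. -/
def UniformlyRigid {X : Type*} [UniformSpace X] (f : X ≃ₜ X) : Prop :=
  ∃ (Λ : Type) (_ : Preorder Λ) (_ : IsDirectedOrder Λ) (_ : Nonempty Λ) (n : Λ → ℤ),
    Monotone n ∧ Tendsto n atTop atTop ∧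
    TendstoUniformly (fun k (x : X) => (f ^ n k) x) (fun x => x) atTop

/-- The family of all iterates `fⁿ`, `n ∈ ℤ`, is equicontinuous (at every point). -/
def EquicontinuousFlow {X : Type*} [UniformSpace X] (f : X ≃ₜ X) : Prop :=
  Equicontinuous (fun (n : ℤ) (x : X) => (f ^ n) x)

/-- For every `(x₁, x₂)` there is a net `n_k → +∞` with `(fⁿ x₁, fⁿ x₂) → (x₁, x₂)` along it. -/
def PositivelyPointwiseProductRecurrent {X : Type*} [TopologicalSpace X] (f : X ≃ₜ X) : Prop :=
  ∀ x₁ x₂ : X, ∃ (Λ : Type) (_ : Preorder Λ) (_ : IsDirectedOrder Λ) (_ : Nonempty Λ)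
    (n : Λ → ℤ), Tendsto n atTop atTop ∧
      Tendsto (fun k => ((f ^ n k) x₁, (f ^ n k) x₂)) atTop (𝓝 (x₁, x₂))

/-- For every `(x₁, x₂)` there is a net `n_k → -∞` with `(fⁿ x₁, fⁿ x₂) → (x₁, x₂)` along it. -/
def NegativelyPointwiseProductRecurrent {X : Type*} [TopologicalSpace X] (f : X ≃ₜ X) : Prop :=
  ∀ x₁ x₂ : X, ∃ (Λ : Type) (_ : Preorder Λ) (_ : IsDirectedOrder Λ) (_ : Nonempty Λ)
    (n : Λ → ℤ), Tendsto n atTop atBot ∧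
      Tendsto (fun k => ((f ^ n k) x₁, (f ^ n k) x₂)) atTop (𝓝 (x₁, x₂))

/-- `A ⊆ G` is syndetic if `G = K⁻¹ A` (written additively) for some compact `K ⊆ G`. -/
def IsSyndetic {G : Type*} [AddGroup G] [TopologicalSpace G] (A : Set G) : Prop :=
  ∃ K : Set G, IsCompact K ∧ ∀ g : G, ∃ k ∈ K, ∃ a ∈ A, g = -k + a

/-- For every entourage `α` there is a syndetic normal subgroup `A` of `ℤ` such that
`A x ⊆ α[x]` for all `x`. -/
def RegularlyAlmostPeriodic {X : Type*} [UniformSpace X] (f : X ≃ₜ X) : Prop :=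
  ∀ α ∈ 𝓤 X, ∃ A : AddSubgroup ℤ, A.Normal ∧ IsSyndetic (A : Set ℤ) ∧
    ∀ x : X, ∀ a ∈ A, (x, (f ^ a) x) ∈ α

end Homeo

end ZeroDimFlow

/-! The pivot is `HasInvariantEquivBase`. By zero-dimensionality every entourage contains a clopen
equivalence relation `r`, and the complement of its invariant core is the `f × f`-saturation of the
clopen set `rᶜ`. If all pairs return at positive times, compactness bounds the return times to `rᶜ`,
so the saturation is closed and the core is an entourage (`PairsReturn.hasInvariantEquivBase`).
Equicontinuity gives the same directly. Then `f` permutes the finitely many classes of the core, and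
a power of `f` fixes each class: regular almost periodicity. This yields rigidity along factorials
and recurrence through every cone. Conversely, each recurrence condition makes pairs return under
`f` or `f⁻¹`. -/

namespace ZeroDimFlow

/-! ### Word length and cones in `ℤ`. -/

section Words

universe u

theorem mem_iterSum_iff (r : ℕ) (g : ℤ) : g ∈ iterSum ({0, 1, -1} : Set ℤ) r ↔ g.natAbs ≤ r := by
  constructor
  · rintro ⟨l, rfl, hl, rfl⟩
    induction l with
    | nil => simp
    | cons a l ih =>
      have h1 := ih fun γ hγ => hl γ (List.mem_cons_of_mem _ hγ)
      have h2 : a = 0 ∨ a = 1 ∨ a = -1 := by simpa using hl a List.mem_cons_self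
      simp only [List.sum_cons, List.length_cons]
      omega
  · intro h
    refine ⟨List.replicate g.natAbs g.sign ++ List.replicate (r - g.natAbs) 0, ?_, ?_, ?_⟩
    · simp; omega
    · intro γ hγ
      simp only [List.mem_append, List.mem_replicate] at hγ
      rcases hγ with ⟨_, rfl⟩ | ⟨_, rfl⟩
      · rcases Int.sign_trichotomy g with h | h | h <;> simp [h]
      · simp
    · simp only [List.sum_append, List.sum_replicate, smul_zero, add_zero, nsmul_eq_mul]
      rw [mul_comm, Int.sign_mul_natAbs]

theorem wordLength_eq_natAbs (g : ℤ) : wordLength ({0, 1, -1} : Set ℤ) g = g.natAbs := by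
  have : {r : ℕ | g ∈ iterSum ({0, 1, -1} : Set ℤ) r} = Set.Ici g.natAbs := by
    ext r
    simp [mem_iterSum_iff]
  rw [wordLength, this, csInf_Ici]

theorem mem_coneBlock_iff (g k : ℤ) :
    k ∈ coneBlock ({0, 1, -1} : Set ℤ) g ↔ (k - g).natAbs ≤ g.natAbs - 1 := by
  simp only [coneBlock, wordLength_eq_natAbs, mem_iterSum_iff, mem_ofPred_eq]
  constructor
  · rintro ⟨h, hh, rfl⟩
    simpa using hh
  · exact fun h => ⟨k - g, h, by ring⟩

/-- The indices whose set contains `a` are cofinal, hence directed; the constant net on them works.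
-/
theorem mem_netLimsup_of_frequently {G Λ : Type u} [TopologicalSpace G] [Preorder Λ]
    [IsDirectedOrder Λ] [Nonempty Λ] {Y : Λ → Set G} {a : G}
    (h : ∃ᶠ i in atTop, a ∈ Y i) : a ∈ netLimsup Y := by
  have h' := frequently_atTop.1 h
  refine ⟨{i // a ∈ Y i}, inferInstance, ⟨?_⟩, ?_, Subtype.val, fun _ => a, ?_, fun j => j.2,
    tendsto_const_nhds⟩
  · intro i j
    obtain ⟨m, him, hjm⟩ := exists_ge_ge i.1 j.1
    obtain ⟨b, hmb, hb⟩ := h' m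
    exact ⟨⟨b, hb⟩, him.trans hmb, hjm.trans hmb⟩
  · obtain ⟨i⟩ := ‹Nonempty Λ›
    obtain ⟨b, _, hb⟩ := h' i
    exact ⟨⟨b, hb⟩⟩
  · refine tendsto_atTop.2 fun i => ?_
    obtain ⟨b, hib, hb⟩ := h' i
    refine mem_of_superset (Ici_mem_atTop (⟨b, hb⟩ : {i // a ∈ Y i})) fun j hj => ?_
    exact hib.trans hj

/-- The block of `g` is `[1, 2g - 1]` for `g > 0` and its mirror image for `g < 0`, so it contains
`k` or `-k` once `|g| ≥ k`. One of the two occurs frequently. -/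
theorem IsCone.mem_or_neg_mem {C : Set ℤ} (hC : IsCone ({0, 1, -1} : Set ℤ) C) {k : ℤ}
    (hk : 0 < k) : k ∈ C ∨ -k ∈ C := by
  obtain ⟨Λ, _, _, _, g, -, hg, rfl⟩ := hC
  simp only [wordLength_eq_natAbs] at hg
  have h : ∀ᶠ i in atTop, k ∈ coneBlock ({0, 1, -1} : Set ℤ) (g i) ∨
      -k ∈ coneBlock ({0, 1, -1} : Set ℤ) (g i) := by
    filter_upwards [hg.eventually_ge_atTop k.natAbs] with i hi
    simp only [mem_coneBlock_iff]
    omega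
  exact (frequently_or_distrib.1 h.frequently).imp mem_netLimsup_of_frequently
    mem_netLimsup_of_frequently

/-- The blocks are `[1, 2i + 1]`; this cone forces return times to be positive. The shift avoids `g
= 0`, whose block is `{0}` by truncated subtraction. -/
theorem isCone_nat_succ : IsCone ({0, 1, -1} : Set ℤ)
    (netLimsup fun i : ℕ => coneBlock ({0, 1, -1} : Set ℤ) (i + 1)) := by
  refine ⟨ℕ, inferInstance, inferInstance, inferInstance, fun i => (i : ℤ) + 1, ?_, ?_, rfl⟩
  · intro i j hij
    simp only [wordLength_eq_natAbs]
    omega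
  · refine tendsto_atTop_mono (fun i => ?_) tendsto_id
    simp only [wordLength_eq_natAbs, id]
    omega

theorem pos_of_mem_netLimsup_nat_succ {c : ℤ}
    (hc : c ∈ netLimsup fun i : ℕ => coneBlock ({0, 1, -1} : Set ℤ) (i + 1)) : 0 < c := by
  obtain ⟨M, _, _, _, s, y, -, hy, hlim⟩ := hc
  rw [nhds_discrete, tendsto_pure] at hlim
  obtain ⟨j, rfl⟩ := hlim.exists
  have := hy j
  rw [mem_coneBlock_iff] at this
  omega

end Words

/-! ### Recurrence and saturations of clopen sets. -/

section Recurrence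

variable {Y : Type*} [TopologicalSpace Y]

theorem zpow_prodCongr_apply (f : Y ≃ₜ Y) (n : ℤ) (p : Y × Y) :
    ((f.prodCongr f) ^ n) p = ((f ^ n) p.1, (f ^ n) p.2) := by
  let φ : (Y ≃ₜ Y) →* (Y × Y ≃ₜ Y × Y) :=
    { toFun := fun g => g.prodCongr g
      map_one' := rfl
      map_mul' := fun _ _ => rfl }
  exact congrArg (fun g : Y × Y ≃ₜ Y × Y => g p) (map_zpow φ f n).symm

theorem zpow_add_apply (g : Y ≃ₜ Y) (m n : ℤ) (x : Y) :
    (g ^ (m + n)) x = (g ^ m) ((g ^ n) x) := by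
  rw [zpow_add]; rfl

theorem zpow_one_add_apply (g : Y ≃ₜ Y) (n : ℤ) (x : Y) : (g ^ (1 + n)) x = g ((g ^ n) x) := by
  rw [zpow_add_apply, zpow_one]

theorem zpow_add_one_apply (g : Y ≃ₜ Y) (n : ℤ) (x : Y) : (g ^ (n + 1)) x = (g ^ n) (g x) := by
  rw [zpow_add_apply, zpow_one]

theorem zpow_mem_iff_of_forall_mem_iff {g : Y ≃ₜ Y} {V : Set Y} (h : ∀ x, g x ∈ V ↔ x ∈ V)
    (n : ℤ) (x : Y) : (g ^ n) x ∈ V ↔ x ∈ V := by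
  induction n with
  | zero => simp
  | succ n ih => rw [add_comm, zpow_one_add_apply, h, ih]
  | pred n ih =>
    rw [← ih, ← h, ← zpow_one_add_apply, add_sub_cancel]

/-- If all points of a compact space are recurrent, the return times to a clopen set are bounded,
hence its saturation is clopen. -/
theorem isClosed_saturation_of_recurrent [CompactSpace Y] (g : Y ≃ₜ Y)
    (hg : ∀ y, ∀ U ∈ 𝓝 y, ∃ n : ℤ, 0 < n ∧ (g ^ n) y ∈ U) {U : Set Y} (hU : IsClopen U) :
    IsClosed {x | ∃ n : ℤ, (g ^ n) x ∈ U} := by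
  obtain ⟨N, hN⟩ : ∃ N : ℕ, ∀ u ∈ U, ∃ r : ℕ, 0 < r ∧ r ≤ N ∧ (g ^ (r : ℤ)) u ∈ U := by
    obtain ⟨t, ht⟩ := hU.isClosed.isCompact.elim_finite_subcover
      (fun n : ℕ => (g ^ ((n + 1 : ℕ) : ℤ)) ⁻¹' U)
      (fun n => hU.isOpen.preimage (g ^ ((n + 1 : ℕ) : ℤ)).continuous) (fun u hu => by
        obtain ⟨n, hn, h⟩ := hg u U (hU.isOpen.mem_nhds hu)
        refine mem_iUnion.2 ⟨(n - 1).toNat, ?_⟩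
        have : (((n - 1).toNat + 1 : ℕ) : ℤ) = n := by omega
        rwa [mem_preimage, this])
    refine ⟨t.sup id + 1, fun u hu => ?_⟩
    obtain ⟨n, hn, h⟩ := mem_iUnion₂.1 (ht hu)
    exact ⟨n + 1, by omega, Nat.succ_le_succ (Finset.le_sup (f := id) hn), h⟩
  -- A finite union suffices: `N` consecutive translates of `U` already exhaust the saturation.
  set V : Set Y := ⋃ j ∈ Finset.range N, (g ^ (-(j : ℤ))) ⁻¹' U with hV
  have hVc : IsClopen V :=
    isClopen_biUnion_finset fun j _ => hU.preimage (g ^ (-(j : ℤ))).continuous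
  have hfwd : ∀ x ∈ V, g x ∈ V := by
    intro x hx
    simp only [hV, mem_iUnion, Finset.mem_range, mem_preimage] at hx ⊢
    obtain ⟨j, hj, hx⟩ := hx
    have key : ∀ m n : ℤ, m + 1 = n - j → (g ^ m) (g x) = (g ^ n) ((g ^ (-(j : ℤ))) x) := by
      intro m n h
      rw [← zpow_add_apply, ← sub_eq_add_neg, ← h, zpow_add_one_apply]
    by_cases hjN : j + 1 < N
    · refine ⟨j + 1, hjN, ?_⟩
      rw [key _ 0 (by push_cast; ring)]
      simpa using hx
    -- At the end of the window, restart from the return `g ^ r` of the point of `U`; the elapsed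
    -- time drops to `N - r < N`.
    · obtain ⟨r, hr0, hrN, hr⟩ := hN _ hx
      refine ⟨N - r, by omega, ?_⟩
      rwa [key _ r (by omega)]
  have hiter : ∀ x ∈ V, ∀ n : ℕ, (g ^ (n : ℤ)) x ∈ V := by
    intro x hx n
    induction n with
    | zero => simpa using hx
    | succ n ih =>
      have := hfwd _ ih
      rwa [← zpow_one_add_apply, add_comm] at this
  have hiff : ∀ x, g x ∈ V ↔ x ∈ V := by
    refine fun x => ⟨fun h => ?_, hfwd x⟩
    -- If `g x ∈ V`, the forward orbit never leaves `V`, so `x` cannot return to the open set `Vᶜ`.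
    by_contra hx
    obtain ⟨n, hn, hnx⟩ := hg x Vᶜ (hVc.compl.isOpen.mem_nhds hx)
    refine hnx ?_
    have := hiter _ h (n - 1).toNat
    rw [← zpow_add_one_apply] at this
    have e : ((n - 1).toNat : ℤ) + 1 = n := by omega
    rwa [e] at this
  have hUV : U ⊆ V := by
    intro u hu
    obtain ⟨r, hr0, hrN, -⟩ := hN u hu
    exact mem_iUnion₂.2 ⟨0, Finset.mem_range.2 (by omega), by simpa using hu⟩
  convert hVc.isClosed using 1
  ext x
  constructor
  · rintro ⟨n, hn⟩
    exact (zpow_mem_iff_of_forall_mem_iff hiff n x).1 (hUV hn)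
  · intro hx
    obtain ⟨j, _, hj⟩ := mem_iUnion₂.1 hx
    exact ⟨_, hj⟩

/-- Every pair of points returns at some positive time to each of its neighbourhoods. -/
def PairsReturn (f : Y ≃ₜ Y) : Prop :=
  ∀ x y : Y, ∀ U ∈ 𝓝 (x, y), ∃ n : ℤ, 0 < n ∧ ((f ^ n) x, (f ^ n) y) ∈ U

theorem PairsReturn.of_inv {f : Y ≃ₜ Y}
    (h : ∀ x y : Y, ∀ U ∈ 𝓝 (x, y), ∃ n : ℤ, n < 0 ∧ ((f ^ n) x, (f ^ n) y) ∈ U) :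
    PairsReturn f⁻¹ := by
  intro x y U hU
  obtain ⟨n, hn, hxy⟩ := h x y U hU
  exact ⟨-n, by omega, by rwa [inv_zpow', neg_neg]⟩

theorem PointwiseProductRecurrentTypeI.pairsReturn {f : Y ≃ₜ Y}
    (h : PointwiseProductRecurrentTypeI ({0, 1, -1} : Set ℤ) f) : PairsReturn f := by
  intro x y U hU
  obtain ⟨c, hc, hcU⟩ := h (x, y) _ isCone_nat_succ U hU
  rw [zpow_prodCongr_apply] at hcU
  exact ⟨c, pos_of_mem_netLimsup_nat_succ hc, hcU⟩

theorem PositivelyPointwiseProductRecurrent.pairsReturn {f : Y ≃ₜ Y}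
    (h : PositivelyPointwiseProductRecurrent f) : PairsReturn f := by
  intro x y U hU
  obtain ⟨Λ, _, _, _, n, hn, hlim⟩ := h x y
  obtain ⟨k, hk, hkU⟩ := ((hn.eventually_gt_atTop 0).and (hlim hU)).exists
  exact ⟨n k, hk, hkU⟩

theorem NegativelyPointwiseProductRecurrent.pairsReturn_inv {f : Y ≃ₜ Y}
    (h : NegativelyPointwiseProductRecurrent f) : PairsReturn f⁻¹ := by
  refine .of_inv fun x y U hU => ?_
  obtain ⟨Λ, _, _, _, n, hn, hlim⟩ := h x y
  obtain ⟨k, hk, hkU⟩ := ((hn.eventually_lt_atBot 0).and (hlim hU)).exists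
  exact ⟨n k, hk, hkU⟩

end Recurrence

/-! ### Invariant equivalence relations and the implications. -/

section Uniform

variable {X : Type*} [UniformSpace X]

theorem exists_entourage_of_mem_nhds_pair {x y : X} {U : Set (X × X)} (hU : U ∈ 𝓝 (x, y)) :
    ∃ ε ∈ 𝓤 X, ∀ a b, (a, x) ∈ ε → (b, y) ∈ ε → (a, b) ∈ U := by
  obtain ⟨A, hA, B, hB, hAB⟩ := mem_nhds_prod_iff.1 hU
  rw [UniformSpace.mem_nhds_iff_symm] at hA hB
  obtain ⟨V, hV, hVs, hVA⟩ := hA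
  obtain ⟨W, hW, hWs, hWB⟩ := hB
  exact ⟨V ∩ W, inter_mem hV hW, fun a b ha hb =>
    hAB ⟨hVA (UniformSpace.mem_ball_symmetry.2 ha.1), hWB (UniformSpace.mem_ball_symmetry.2 hb.2)⟩⟩

/-- The sign of `n` is not controlled. A pair failing for positive times and one failing for
negative times are tested together, as four points. -/
theorem WeaklyRigid.pairsReturn_or {f : X ≃ₜ X} (h : WeaklyRigid f) :
    PairsReturn f ∨ PairsReturn f⁻¹ := by
  by_contra! hne
  obtain ⟨h₁, h₂⟩ := hne
  have h₂' := mt PairsReturn.of_inv h₂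
  simp only [PairsReturn] at h₁
  push Not at h₁ h₂'
  obtain ⟨x, y, U, hU, hUn⟩ := h₁
  obtain ⟨x', y', U', hU', hUn'⟩ := h₂'
  obtain ⟨ε, hε, hεU⟩ := exists_entourage_of_mem_nhds_pair hU
  obtain ⟨δ, hδ, hδU⟩ := exists_entourage_of_mem_nhds_pair hU'
  obtain ⟨n, hn, hmem⟩ := h (ε ∩ δ) (inter_mem hε hδ) 4 ![x, y, x', y']
  rcases lt_or_gt_of_ne hn with hn | hn
  · exact hUn' n hn (hδU _ _ (hmem 2).2 (hmem 3).2)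
  · exact hUn n hn (hεU _ _ (hmem 0).1 (hmem 1).1)

/-- The entourages that are equivalence relations invariant under `f` form a base of the
uniformity. -/
def HasInvariantEquivBase (f : X ≃ₜ X) : Prop :=
  ∀ α ∈ 𝓤 X, ∃ r : Setoid X, {p : X × X | r p.1 p.2} ∈ 𝓤 X ∧ (∀ x y, r x y → (x, y) ∈ α) ∧
    ∀ (n : ℤ) (x y : X), r x y → r ((f ^ n) x) ((f ^ n) y)

theorem HasInvariantEquivBase.of_inv {f : X ≃ₜ X} (h : HasInvariantEquivBase f⁻¹) :
    HasInvariantEquivBase f := by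
  intro α hα
  obtain ⟨r, hr, hrα, hinv⟩ := h α hα
  refine ⟨r, hr, hrα, fun n x y hxy => ?_⟩
  simpa using hinv (-n) x y hxy

theorem HasInvariantEquivBase.equicontinuousFlow {f : X ≃ₜ X} (h : HasInvariantEquivBase f) :
    EquicontinuousFlow f := by
  refine UniformEquicontinuous.equicontinuous fun α hα => ?_
  obtain ⟨r, hr, hrα, hinv⟩ := h α hα
  filter_upwards [hr] with p hp n
  exact hrα _ _ (hinv n _ _ hp)

theorem IsZeroDimensional.exists_clopen_setoid [CompactSpace X] (hX : IsZeroDimensional X)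
    {α : Set (X × X)} (hα : α ∈ 𝓤 X) :
    ∃ r : Setoid X, IsClopen {p : X × X | r p.1 p.2} ∧ ∀ x y, r x y → (x, y) ∈ α := by
  have hP : ∀ x : X, ∃ P : Set X, IsClopen P ∧ x ∈ P ∧ P ×ˢ P ⊆ α := by
    intro x
    have : α ∈ 𝓝 (x, x) := nhds_le_uniformity x hα
    rw [nhds_prod_eq, mem_prod_same_iff] at this
    obtain ⟨t, ht, htα⟩ := this
    obtain ⟨P, hP, hxP, hPt⟩ := hX.mem_nhds_iff.1 ht
    exact ⟨P, hP, hxP, (prod_mono hPt hPt).trans htα⟩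
  choose P hPc hxP hPα using hP
  obtain ⟨t, ht⟩ := isCompact_univ.elim_finite_subcover P (fun x => (hPc x).isOpen)
    (fun x _ => mem_iUnion.2 ⟨x, hxP x⟩)
  -- Two points are equivalent when they lie in the same members of a finite clopen cover by
  -- `α`-small sets.
  let r : Setoid X := ⟨fun x y => ∀ i ∈ t, x ∈ P i ↔ y ∈ P i, fun _ _ _ => Iff.rfl,
    fun h i hi => (h i hi).symm, fun h h' i hi => (h i hi).trans (h' i hi)⟩
  refine ⟨r, ?_, fun x y hxy => ?_⟩
  · have : {p : X × X | r p.1 p.2} =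
        ⋂ i ∈ t, (P i ×ˢ P i) ∪ ((P i)ᶜ ×ˢ (P i)ᶜ) := by
      ext p
      simp only [mem_iInter, mem_ofPred_eq, mem_union, mem_prod, mem_compl_iff]
      exact forall₂_congr fun i _ => iff_iff_and_or_not_and_not
    rw [this]
    exact isClopen_biInter_finset fun i _ =>
      ((hPc i).prod (hPc i)).union ((hPc i).compl.prod (hPc i).compl)
  · obtain ⟨i, hi, hx⟩ := mem_iUnion₂.1 (ht (mem_univ x))
    exact hPα i ⟨hx, (hxy i hi).1 hx⟩

/-- The largest `f`-invariant equivalence relation contained in `r`. -/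
def invariantCore (f : X ≃ₜ X) (r : Setoid X) : Setoid X where
  r x y := ∀ n : ℤ, r ((f ^ n) x) ((f ^ n) y)
  iseqv := ⟨fun _ _ => r.refl _, fun h n => r.symm (h n), fun h h' n => r.trans (h n) (h' n)⟩

theorem hasInvariantEquivBase_of_invariantCore [CompactSpace X] (hX : IsZeroDimensional X)
    {f : X ≃ₜ X}
    (h : ∀ r : Setoid X, IsClopen {p : X × X | r p.1 p.2} →
      {p : X × X | invariantCore f r p.1 p.2} ∈ 𝓤 X) : HasInvariantEquivBase f := by
  intro α hα
  obtain ⟨r, hr, hrα⟩ := hX.exists_clopen_setoid hα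
  refine ⟨invariantCore f r, h r hr, fun x y hxy => hrα x y (by simpa using hxy 0),
    fun n x y hxy m => ?_⟩
  rw [← zpow_add_apply, ← zpow_add_apply]
  exact hxy (m + n)

theorem mem_uniformity_of_isOpen_setoid [CompactSpace X] {r : Setoid X}
    (hr : IsOpen {p : X × X | r p.1 p.2}) : {p : X × X | r p.1 p.2} ∈ 𝓤 X := by
  rw [← nhdsSet_diagonal_eq_uniformity]
  refine hr.mem_nhdsSet.2 ?_
  rintro ⟨x, y⟩ hxy
  obtain rfl : x = y := hxy
  exact r.refl x

theorem PairsReturn.hasInvariantEquivBase [CompactSpace X] (hX : IsZeroDimensional X)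
    {f : X ≃ₜ X} (h : PairsReturn f) : HasInvariantEquivBase f := by
  refine hasInvariantEquivBase_of_invariantCore hX fun r hr => mem_uniformity_of_isOpen_setoid ?_
  have hcl := isClosed_saturation_of_recurrent (f.prodCongr f) (fun p U hU => by
    simpa only [zpow_prodCongr_apply] using h p.1 p.2 U hU) hr.compl
  rw [← isClosed_compl_iff]
  convert hcl using 1
  ext p
  simp only [zpow_prodCongr_apply, mem_compl_iff, mem_ofPred_eq, ← not_forall]
  rfl

theorem EquicontinuousFlow.hasInvariantEquivBase [CompactSpace X] (hX : IsZeroDimensional X)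
    {f : X ≃ₜ X} (h : EquicontinuousFlow f) : HasInvariantEquivBase f :=
  hasInvariantEquivBase_of_invariantCore hX fun _ hr =>
    -- Uniform equicontinuity tested on the entourage `r` says exactly that the core is an
    -- entourage.
    CompactSpace.uniformEquicontinuous_of_equicontinuous h _
      (mem_uniformity_of_isOpen_setoid hr.isOpen)

/-- Some positive power of `f` generates a group acting `α`-trivially. -/
theorem HasInvariantEquivBase.exists_zpow_mul_mem [CompactSpace X] {f : X ≃ₜ X}
    (h : HasInvariantEquivBase f) {α : Set (X × X)} (hα : α ∈ 𝓤 X) :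
    ∃ k : ℕ, 0 < k ∧ ∀ (m : ℤ) (x : X), (x, (f ^ (k * m)) x) ∈ α := by
  obtain ⟨r, hr, hrα, hinv⟩ := h α hα
  -- Classes are open, so the compact quotient is discrete, hence finite.
  have hopen : ∀ q : Quotient r, IsOpen ({q} : Set (Quotient r)) := by
    intro q
    rw [isOpen_coinduced, isOpen_iff_mem_nhds]
    rintro x rfl
    filter_upwards [UniformSpace.ball_mem_nhds x hr] with y hy
    exact Quotient.sound (r.symm hy)
  have : DiscreteTopology (Quotient r) := discreteTopology_iff_forall_isOpen.2 fun s => by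
    rw [← biUnion_of_singleton s]
    exact isOpen_biUnion fun q _ => hopen q
  have : Finite (Quotient r) := finite_of_compact_of_discrete
  let σ : Equiv.Perm (Quotient r) := Quotient.congr f.toEquiv fun x y =>
    ⟨fun hxy => by simpa using hinv 1 x y hxy, fun hxy => by simpa using hinv (-1) _ _ hxy⟩
  have hσ : ∀ x : X, σ (Quotient.mk r x) = Quotient.mk r (f x) := fun _ => rfl
  have hσn : ∀ (n : ℕ) (x : X), (σ ^ n) (Quotient.mk r x) = Quotient.mk r ((f ^ (n : ℤ)) x) := by
    intro n x
    induction n with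
    | zero => simp
    | succ n ih =>
      rw [pow_succ', Equiv.Perm.mul_apply, ih, hσ, Nat.cast_succ, add_comm,
        zpow_one_add_apply]
  have hk : ∀ x : X, r ((f ^ ((orderOf σ : ℕ) : ℤ)) x) x := by
    intro x
    refine Quotient.exact (s := r) ?_
    rw [← hσn, pow_orderOf_eq_one]
    rfl
  refine ⟨orderOf σ, orderOf_pos σ, fun m x => hrα _ _ ?_⟩
  induction m generalizing x with
  | zero => simp
  | succ m ih =>
    rw [mul_add, mul_one, zpow_add_apply]
    exact r.trans (r.symm (hk x)) (ih _)
  | pred m ih =>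
    refine r.trans (ih x) ?_
    have := hk ((f ^ ((orderOf σ : ℤ) * (-m - 1))) x)
    rw [← zpow_add_apply] at this
    convert this using 3
    ring_nf

theorem HasInvariantEquivBase.regularlyAlmostPeriodic [CompactSpace X] {f : X ≃ₜ X}
    (h : HasInvariantEquivBase f) : RegularlyAlmostPeriodic f := by
  intro α hα
  obtain ⟨k, hk, hkα⟩ := h.exists_zpow_mul_mem hα
  refine ⟨AddSubgroup.zmultiples (k : ℤ), inferInstance, ⟨Set.Icc (-k) k,
    (Set.finite_Icc _ _).isCompact, fun g => ?_⟩, fun x a ha => ?_⟩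
  · have h1 := Int.emod_nonneg g (b := k) (by omega)
    have h2 := Int.emod_lt_of_pos g (b := k) (by omega)
    refine ⟨-(g % k), ⟨by omega, by omega⟩, k * (g / k),
      Int.mem_zmultiples_iff.2 (dvd_mul_right _ _), ?_⟩
    rw [neg_neg, Int.emod_add_mul_ediv]
  · obtain ⟨m, rfl⟩ := Int.mem_zmultiples_iff.1 ha
    exact hkα m x

theorem IsSyndetic.exists_pos_mem {A : AddSubgroup ℤ} (hA : IsSyndetic (A : Set ℤ)) :
    ∃ k ∈ A, 0 < k := by
  obtain ⟨K, hK, hKA⟩ := hA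
  obtain ⟨b, hb⟩ := (isCompact_iff_finite.1 hK).bddBelow
  -- With `b` a lower bound of `K`, this gives `a = k - b + 1 ≥ 1`.
  obtain ⟨k, hk, a, ha, hka⟩ := hKA (-b + 1)
  have := hb hk
  exact ⟨a, ha, by omega⟩

theorem RegularlyAlmostPeriodic.exists_zpow_mul_mem {f : X ≃ₜ X} (h : RegularlyAlmostPeriodic f)
    {α : Set (X × X)} (hα : α ∈ 𝓤 X) :
    ∃ k : ℤ, 0 < k ∧ ∀ n, k ∣ n → ∀ x, (x, (f ^ n) x) ∈ α := by
  obtain ⟨A, -, hA, hAα⟩ := h α hα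
  obtain ⟨k, hkA, hk⟩ := hA.exists_pos_mem
  refine ⟨k, hk, ?_⟩
  rintro _ ⟨m, rfl⟩ x
  refine hAα x _ ?_
  rw [mul_comm, ← smul_eq_mul]
  exact A.zsmul_mem hkA m

/-- Factorials are eventually divisible by every period, so one sequence serves all entourages; `s =
±1` gives both time directions. -/
theorem RegularlyAlmostPeriodic.tendstoUniformly_factorial {f : X ≃ₜ X}
    (h : RegularlyAlmostPeriodic f) (s : ℤ) :
    TendstoUniformly (fun (k : ℕ) (x : X) => (f ^ (s * (k.factorial : ℤ))) x) (fun x => x)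
      atTop := by
  intro α hα
  obtain ⟨k, hk, hkα⟩ := h.exists_zpow_mul_mem hα
  filter_upwards [eventually_ge_atTop k.toNat] with n hn x
  refine hkα _ (Dvd.dvd.mul_left ?_ s) x
  lift k to ℕ using hk.le
  exact_mod_cast Nat.dvd_factorial (by omega) (by simpa using hn)

theorem tendsto_factorial_cast : Tendsto (fun k : ℕ => (k.factorial : ℤ)) atTop atTop :=
  tendsto_natCast_atTop_atTop.comp (tendsto_atTop_mono Nat.self_le_factorial tendsto_id)

theorem RegularlyAlmostPeriodic.uniformlyRigid {f : X ≃ₜ X} (h : RegularlyAlmostPeriodic f) :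
    UniformlyRigid f :=
  ⟨ℕ, inferInstance, inferInstance, inferInstance, fun k => (k.factorial : ℤ),
    fun _ _ hij => Int.ofNat_le.2 (Nat.factorial_le hij), tendsto_factorial_cast,
    by simpa using h.tendstoUniformly_factorial 1⟩

theorem RegularlyAlmostPeriodic.negativelyPointwiseProductRecurrent {f : X ≃ₜ X}
    (h : RegularlyAlmostPeriodic f) : NegativelyPointwiseProductRecurrent f := fun x y =>
  ⟨ℕ, inferInstance, inferInstance, inferInstance, fun k => -1 * (k.factorial : ℤ),
    by simpa using tendsto_factorial_cast,
    ((h.tendstoUniformly_factorial (-1)).tendsto_at x).prodMk_nhds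
      ((h.tendstoUniformly_factorial (-1)).tendsto_at y)⟩

theorem RegularlyAlmostPeriodic.pointwiseProductRecurrentTypeI {f : X ≃ₜ X}
    (h : RegularlyAlmostPeriodic f) :
    PointwiseProductRecurrentTypeI ({0, 1, -1} : Set ℤ) f := by
  rintro ⟨x, y⟩ C hC U hU
  obtain ⟨ε, hε, hεU⟩ := exists_entourage_of_mem_nhds_pair hU
  obtain ⟨k, hk, hkε⟩ := h.exists_zpow_mul_mem (symm_le_uniformity hε)
  simp only [zpow_prodCongr_apply]
  have key : ∀ c, k ∣ c → ((f ^ c) x, (f ^ c) y) ∈ U := fun c hc =>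
    hεU _ _ (hkε c hc x) (hkε c hc y)
  rcases hC.mem_or_neg_mem hk with hc | hc
  · exact ⟨k, hc, key k dvd_rfl⟩
  · exact ⟨-k, hc, key (-k) (dvd_neg.2 dvd_rfl)⟩

theorem UniformlyRigid.rigid {f : X ≃ₜ X} (h : UniformlyRigid f) : Rigid f := by
  obtain ⟨Λ, i₁, i₂, i₃, n, hm, hn, hu⟩ := h
  exact ⟨Λ, i₁, i₂, i₃, n, hm, hn, fun x => hu.tendsto_at x⟩

theorem Rigid.positivelyPointwiseProductRecurrent {f : X ≃ₜ X} (h : Rigid f) :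
    PositivelyPointwiseProductRecurrent f := by
  obtain ⟨Λ, i₁, i₂, i₃, n, -, hn, hu⟩ := h
  exact fun x y => ⟨Λ, i₁, i₂, i₃, n, hn, (hu x).prodMk_nhds (hu y)⟩

theorem Rigid.weaklyRigid {f : X ≃ₜ X} (h : Rigid f) : WeaklyRigid f := by
  obtain ⟨Λ, _, _, _, n, -, hn, hu⟩ := h
  intro ε hε m x
  have hev : ∀ i, ∀ᶠ k in atTop, ((f ^ n k) (x i), x i) ∈ ε := fun i =>
    hu (x i) (mem_nhds_right (x i) hε)
  obtain ⟨k, hk, hkε⟩ := ((hn.eventually_gt_atTop 0).and (eventually_all.2 hev)).exists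
  exact ⟨n k, hk.ne', hkε⟩

end Uniform

end ZeroDimFlow

theorem theorem3p2p2 {X : Type*} [UniformSpace X] [CompactSpace X] [T2Space X]
    (hX : ZeroDimFlow.IsZeroDimensional X) (f : X ≃ₜ X) :
    List.TFAE [
      ZeroDimFlow.PointwiseProductRecurrentTypeI ({0, 1, -1} : Set ℤ) f,
      ZeroDimFlow.WeaklyRigid f,
      ZeroDimFlow.Rigid f,
      ZeroDimFlow.UniformlyRigid f,
      ZeroDimFlow.EquicontinuousFlow f,
      ZeroDimFlow.PositivelyPointwiseProductRecurrent f,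
      ZeroDimFlow.NegativelyPointwiseProductRecurrent f,
      ZeroDimFlow.RegularlyAlmostPeriodic f] := by
  tfae_have 1 → 5 := fun h => (h.pairsReturn.hasInvariantEquivBase hX).equicontinuousFlow
  tfae_have 2 → 5 := fun h => h.pairsReturn_or.elim
    (fun h => (h.hasInvariantEquivBase hX).equicontinuousFlow)
    (fun h => (h.hasInvariantEquivBase hX).of_inv.equicontinuousFlow)
  tfae_have 3 → 2 := fun h => h.weaklyRigid
  tfae_have 3 → 6 := fun h => h.positivelyPointwiseProductRecurrent
  tfae_have 4 → 3 := fun h => h.rigid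
  tfae_have 5 → 8 := fun h => (h.hasInvariantEquivBase hX).regularlyAlmostPeriodic
  tfae_have 6 → 5 := fun h => (h.pairsReturn.hasInvariantEquivBase hX).equicontinuousFlow
  tfae_have 7 → 5 := fun h =>
    (h.pairsReturn_inv.hasInvariantEquivBase hX).of_inv.equicontinuousFlow
  tfae_have 8 → 1 := fun h => h.pointwiseProductRecurrentTypeI
  tfae_have 8 → 4 := fun h => h.uniformlyRigid
  tfae_have 8 → 7 := fun h => h.negativelyPointwiseProductRecurrent
  tfae_finish
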